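/- Let $\mathcal H$ be an infinite-dimensional separable complex Hilbert space, $\mathcal L_{\mathcal H}$ its bounded linear operators. All processes are families of $\mathcal H$-valued random variables indexed by $t\in\mathbb Z$ on a probability space. *Conventions.* A process $\varepsilon_t$ is white noise if $0<E\|\varepsilon_t\|^2<\infty$, $E\varepsilon_t=0$, the cross-covariances $E\big(\langle v,\varepsilon_t\rangle\overline{\langle w,\varepsilon_s\rangle}\big)$ depend on $(s,t)$ only through $t-s$, and they vanish for $s\ne t$. Let $A(z)=I-\sum_{h=1}^k A^\circ_h z^h$ with $A^\circ_h\in\mathcal L_{\mathcal H}$. It is an *AR operator with a unit root of finite type* if $A(1)\neq 0$, $A(z)$ is (boundedly) invertible for all $z\neq 1$ in some disc $|z|<\rho$, $\rho>1$, and $1$ is an eigenvalue of finite type of $A(z)$: $\dim\operatorname{Ker}A(1)<\infty$, $\dim(\operatorname{Im}A(1))^\perp<\infty$, $A(1)v=0$ for some $v\ne0$, and $A(z)$ is invertible in a punctured disc around $1$. The case $d=1$ means that $A(z)^{-1}$ has a pole of order exactly $1$ at $z=1$. Write $\Delta x_t=x_t-x_{t-1}$. The *Chang–Kim–Park condition*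 for $(x_t,\varepsilon_t)$ is: $\varepsilon_t$ is white noise and $\Delta x_t=B(L)\varepsilon_t=\sum_{n\ge0}B_n\varepsilon_{t-n}$ for every $t$ (convergence almost surely and in mean square), for some $B_n\in\mathcal L_{\mathcal H}$ such that - $x_t$ is $I(1)$ through this representation, i.e. $B_0=I$, $\sum_n\|B_n\||z|^n<\infty$ for all $|z|<\rho$ for some $\rho>1$, and $B(1)=\sum_n B_n\neq0$; - $\sum_{n\ge1} n\|B_n\|<\infty$; - $\operatorname{Im}B(1)$ is finite dimensional. **Proposition.** (1) Let $A(z)$ be an AR operator with a unit root of finite type with $d=1$, let $\varepsilon_t$ be white noise, and let $x_t$ satisfy $A(L)x_t=\varepsilon_t$, i.e. $x_t=\sum_{h=1}^kA^\circ_hx_{t-h}+\varepsilon_t$ almost surely for all $t\in\mathbb Z$. Assume that $x_t$ does not grow exponentially in the remote past: $r^n\|x_{-n}\|\to0$ in probability as $n\to\infty$ for every $0<r<1$ (this holds, for instance, whenever $\Delta x_t$ is weakly stationary). Then $(x_t,\varepsilon_t)$ satisfies the Chang–Kim–Park condition. (2) The converse need not hold: there are a probability space and processes $x_t,\varepsilon_t$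 satisfying the Chang–Kim–Park condition such that $x_t$ is not a solution of $A(L)x_t=\eta_t$ for any AR operator $A(z)$ with a unit root of finite type and any white noise $\eta_t$ on that space. -/

import Mathlib

open MeasureTheory Filter Topology

noncomputable section

/-! ### Second-order processes in a complex Hilbert space -/

section Processes

variable {Ω H : Type*} [MeasurableSpace Ω] [NormedAddCommGroup H] [InnerProductSpace ℂ H]
  [CompleteSpace H] [MeasurableSpace H]

/-- Cross-covariance function
`c_{Z,U}(v,w) = E (⟨v, Z - E Z⟩ * conj ⟨w, U - E U⟩)` (the inner product is conjugate-linear in its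
first argument). -/
def crossCov (P : Measure Ω) (Z U : Ω → H) (v w : H) : ℂ :=
  ∫ ω, inner ℂ v (Z ω - ∫ ω', Z ω' ∂P) * (starRingEnd ℂ) (inner ℂ w (U ω - ∫ ω', U ω' ∂P)) ∂P

/-- Weakly stationary `H`-valued process indexed by `ℤ`. The case `s = t` of `cov_shift` says that
the covariance operator does not depend on time. -/
structure IsWeaklyStationary (P : Measure Ω) (u : ℤ → Ω → H) : Prop where
  measurable : ∀ t, Measurable (u t)
  memLp : ∀ t, MemLp (u t) 2 P
  second_moment_pos : ∀ t, 0 < ∫ ω, ‖u t ω‖ ^ 2 ∂P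
  mean_const : ∀ s t, ∫ ω, u s ω ∂P = ∫ ω, u t ω ∂P
  cov_shift : ∀ (s t r : ℤ) (v w : H),
    crossCov P (u t) (u s) v w = crossCov P (u (t + r)) (u (s + r)) v w

/-- White noise: weakly stationary, centred, and uncorrelated over time. -/
structure IsWhiteNoise (P : Measure Ω) (ε : ℤ → Ω → H) : Prop where
  weaklyStationary : IsWeaklyStationary P ε
  mean_zero : ∀ t, ∫ ω, ε t ω ∂P = 0
  uncorrelated : ∀ s t : ℤ, s ≠ t → ∀ v w : H, crossCov P (ε t) (ε s) v w = 0

/-- `u_t = B(L) ε_t = ∑ n, B_n ε_{t-n}` for all `t`, the series converging both almost surely and in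
mean square. -/
def IsFilterOf (P : Measure Ω) (u : ℤ → Ω → H) (B : ℕ → H →L[ℂ] H) (ε : ℤ → Ω → H) : Prop :=
  ∀ t : ℤ,
    (∀ᵐ ω ∂P, HasSum (fun n : ℕ => B n (ε (t - n) ω)) (u t ω)) ∧
    Tendsto
      (fun N : ℕ => eLpNorm (fun ω => u t ω - ∑ n ∈ Finset.range N, B n (ε (t - n) ω)) 2 P)
      atTop (𝓝 0)

/-- The differenced process `Δ x_t = x_t - x_{t-1}`. -/
def diffProcess (x : ℤ → Ω → H) : ℤ → Ω → H := fun t ω => x t ω - x (t - 1) ω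

/-- `x` does not grow exponentially in the remote past: `r ^ n * ‖x_{-n}‖ → 0` in probability as
`n → ∞`, for every `0 < r < 1`. -/
def HasSubexponentialPast (P : Measure Ω) (x : ℤ → Ω → H) : Prop :=
  ∀ r : ℝ, 0 < r → r < 1 →
    TendstoInMeasure P (fun (n : ℕ) ω => r ^ n * ‖x (-(n : ℤ)) ω‖) atTop (fun _ => (0 : ℝ))

/-- The Chang--Kim--Park condition: `x` is an `I(1)` process with `Δ x_t = B(L) ε_t`, where `ε` is
white noise, `∑ n ‖B_n‖ < ∞` and the image of `B(1)` is finite dimensional. That `x` is `I(1)` is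
expressed by the first three clauses on `B`: they say that the centred process `Δ x` is a linear
process, `B(z)` being absolutely convergent on a disc of radius larger than one and `B_0 = I`, and
that it is `I(0)`, that is, `B(1) ≠ 0`. -/
def ChangKimParkCondition (P : Measure Ω) (x ε : ℤ → Ω → H) : Prop :=
  (∀ t, Measurable (x t)) ∧ IsWhiteNoise P ε ∧
  ∃ B : ℕ → H →L[ℂ] H,
    (∃ ρ : ℝ, 1 < ρ ∧ ∀ z ∈ Metric.ball (0 : ℂ) ρ, Summable fun n : ℕ => ‖B n‖ * ‖z‖ ^ n) ∧
    B 0 = 1 ∧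
    (∑' n, B n) ≠ 0 ∧
    (Summable fun n : ℕ => (n : ℝ) * ‖B n‖) ∧
    FiniteDimensional ℂ (LinearMap.range (∑' n, B n : H →L[ℂ] H).toLinearMap) ∧
    IsFilterOf P (diffProcess x) B ε

end Processes

/-! ### Autoregressions with a unit root of finite type -/

section Autoregressions

variable {H : Type*} [NormedAddCommGroup H] [InnerProductSpace ℂ H] [CompleteSpace H]

/-- `z₀` is an eigenvalue of finite type of the operator function `W`: `W z₀` has finite dimensional
kernel, its image has finite dimensional orthogonal complement, `W z₀` is not injective, and `W z` is
boundedly invertible on a punctured disc around `z₀`. -/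
structure IsEigenvalueOfFiniteType (W : ℂ → H →L[ℂ] H) (z₀ : ℂ) : Prop where
  finite_ker : FiniteDimensional ℂ (LinearMap.ker (W z₀).toLinearMap)
  finite_coker : FiniteDimensional ℂ (LinearMap.range (W z₀).toLinearMap)ᗮ
  exists_ker : ∃ v : H, v ≠ 0 ∧ W z₀ v = 0
  isolated : ∃ δ : ℝ, 0 < δ ∧ ∀ z ∈ Metric.ball z₀ δ, z ≠ z₀ → IsUnit (W z)

/-- `A(z) = I - ∑_{h=1}^k A°_h z^h`, where `A°_{h+1}` is `a h` for `h = 0, …, k - 1`. -/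
def arOperator {k : ℕ} (a : Fin k → H →L[ℂ] H) (z : ℂ) : H →L[ℂ] H :=
  1 - ∑ h : Fin k, z ^ ((h : ℕ) + 1) • a h

/-- `A(z)` is an autoregressive operator function with a unit root of finite type at `z = 1`. -/
structure IsUnitRootOfFiniteType {k : ℕ} (a : Fin k → H →L[ℂ] H) : Prop where
  ne_zero : arOperator a 1 ≠ 0
  invertible : ∃ ρ : ℝ, 1 < ρ ∧ ∀ z ∈ Metric.ball (0 : ℂ) ρ, z ≠ 1 → IsUnit (arOperator a z)
  finiteType : IsEigenvalueOfFiniteType (arOperator a) 1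

/-- The inverse operator function `z ↦ A(z)⁻¹` has a pole of order exactly `d` at `z = 1`. -/
def HasPoleOfOrder {k : ℕ} (a : Fin k → H →L[ℂ] H) (d : ℕ) : Prop :=
  meromorphicOrderAt (fun z => Ring.inverse (arOperator a z)) 1 = ((-(d : ℤ) : ℤ) : WithTop ℤ)

/-- `x` solves `A(L) x_t = ε_t`, that is, `x_t = A°_1 x_{t-1} + ⋯ + A°_k x_{t-k} + ε_t` for all
`t ∈ ℤ`, almost surely. -/
def SolvesAR {Ω : Type*} [MeasurableSpace Ω] (P : Measure Ω) {k : ℕ} (a : Fin k → H →L[ℂ] H)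
    (x ε : ℤ → Ω → H) : Prop :=
  ∀ t : ℤ, ∀ᵐ ω ∂P, x t ω = (∑ h : Fin k, a h (x (t - ((h : ℕ) + 1 : ℤ)) ω)) + ε t ω

end Autoregressions

end

/-! For the first claim, a simple pole means that `(1 - z) A(z)⁻¹` extends holomorphically to a disc
of radius larger than one. Its Taylor coefficients `B_n` therefore decay geometrically, and `B(z)
A(z) = 1 - z` holds coefficient by coefficient (`exists_seriesInverse`). Since `A(1) B(1) = 0`, the
image of `B(1)` lies in the finite dimensional kernel of `A(1)`, and `B(1) ≠ 0` because the pole is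
genuine. Applying the truncation of `B(L)` at `N` to `A(L) x = ε` leaves `Δ x_t` plus boundedly many
terms of size `O(r ^ N)` times values of `x` near time `t - N` (`sum_apply_ar_eq`,
`norm_ar_remainder_le`). Subexponential growth kills these along a subsequence, almost surely. The
noise has constant second moment, so the full series converges absolutely almost surely, and the
subsequence identifies its sum (`ae_hasSum_diffProcess`).

For the second claim, take `B(z) = (1 + z)(1 - z (1 - Q))` with `Q` of finite nonzero rank. Then
`B(1) = 2 Q`, but `B(-1) = 0`, so the moving average is not invertible. If `A(L) x = η` with any
white noise `η`, the factor `1 + L` forces the alternating sums of `η` to stay bounded in mean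
square, while their variance grows linearly. Hence `η = 0`, which is excluded
(`not_solvesAR_of_diffProcess_eq`). -/

open MeasureTheory Filter Topology

noncomputable section

/-! ### Power series of `(1 - z) A(z)⁻¹` -/

section SeriesInverse

variable {H : Type*} [NormedAddCommGroup H] [InnerProductSpace ℂ H]

/-- The coefficients of the polynomial `arOperator a`. -/
def arCoeff {k : ℕ} (a : Fin k → H →L[ℂ] H) : ℕ → H →L[ℂ] H
  | 0 => 1
  | j + 1 => if h : j < k then -a ⟨j, h⟩ else 0

lemma arCoeff_eq_zero {k : ℕ} (a : Fin k → H →L[ℂ] H) {j : ℕ} (hj : k < j) :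
    arCoeff a j = 0 := by
  obtain ⟨j, rfl⟩ := Nat.exists_eq_succ_of_ne_zero (show j ≠ 0 by omega)
  simp only [arCoeff]
  rw [dif_neg (by omega)]

lemma sum_arCoeff {k : ℕ} (a : Fin k → H →L[ℂ] H) {M : Type*} [AddCommGroup M]
    (f : ℕ → (H →L[ℂ] H) →+ M) :
    ∑ j ∈ Finset.range (k + 1), f j (arCoeff a j) = f 0 1 - ∑ h : Fin k, f (h + 1) (a h) := by
  rw [Finset.sum_range_succ', add_comm, sub_eq_add_neg, Finset.sum_range, ← Finset.sum_neg_distrib]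
  simp [arCoeff]

lemma arOperator_eq_sum [CompleteSpace H] {k : ℕ} (a : Fin k → H →L[ℂ] H) (z : ℂ) :
    arOperator a z = ∑ j ∈ Finset.range (k + 1), z ^ j • arCoeff a j := by
  have := sum_arCoeff a (fun j => DistribSMul.toAddMonoidHom (H →L[ℂ] H) (z ^ j))
  simpa [arOperator] using this.symm

lemma differentiable_arOperator [CompleteSpace H] {k : ℕ} (a : Fin k → H →L[ℂ] H) :
    Differentiable ℂ (arOperator a) := by
  unfold arOperator
  fun_prop

/-- If `A(z)⁻¹` has a simple pole at `1`, then `(1 - z) A(z)⁻¹` extends holomorphically. -/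
lemma exists_holomorphic_extension [CompleteSpace H] {k : ℕ} {a : Fin k → H →L[ℂ] H} {ρ : ℝ}
    (hρ : 1 < ρ)
    (hinv : ∀ z ∈ Metric.ball (0 : ℂ) ρ, z ≠ 1 → IsUnit (arOperator a z))
    (hd : HasPoleOfOrder a 1) :
    ∃ F : ℂ → H →L[ℂ] H, DifferentiableOn ℂ F (Metric.ball 0 ρ) ∧ F 1 ≠ 0 ∧
      (∀ z ∈ Metric.ball (0 : ℂ) ρ, arOperator a z * F z = (1 - z) • 1) ∧
      (∀ z ∈ Metric.ball (0 : ℂ) ρ, F z * arOperator a z = (1 - z) • 1) := by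
  unfold HasPoleOfOrder at hd
  -- The order is zero by convention for a function that is not meromorphic, so order `-1` already
  -- implies meromorphy.
  have hmer : MeromorphicAt (fun z => Ring.inverse (arOperator a z)) 1 := by
    apply meromorphicAt_of_meromorphicOrderAt_ne_zero
    rw [hd]
    decide
  obtain ⟨g, hg, hg1, hgF⟩ := (meromorphicOrderAt_eq_int_iff hmer).1 hd
  -- Near `1` the inverse is `(z - 1)⁻¹ • g z`, so the removable value of its product with `1 - z`
  -- is `-g 1`.
  set F : ℂ → H →L[ℂ] H :=
    Function.update (fun z => (1 - z) • Ring.inverse (arOperator a z)) 1 (-g 1) with hF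
  have hFne : ∀ z, z ≠ 1 → F z = (1 - z) • Ring.inverse (arOperator a z) := fun z hz => by
    simp [hF, hz]
  have hFg : F =ᶠ[𝓝 1] fun z => -g z := by
    rw [eventually_nhdsWithin_iff] at hgF
    filter_upwards [hgF] with z hz
    by_cases h : z = 1
    · simp [hF, h]
    · rw [hFne z h, hz h, smul_smul]
      have : z - 1 ≠ 0 := sub_ne_zero.2 h
      have : (1 - z) * (z - 1) ^ (-((1 : ℕ) : ℤ)) = -1 := by
        simp only [Nat.cast_one, zpow_neg, zpow_one]
        field_simp
        ring
      rw [this, neg_one_smul]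
  have hdiff : DifferentiableOn ℂ F (Metric.ball 0 ρ) := by
    intro z hz
    apply DifferentiableAt.differentiableWithinAt
    by_cases h : z = 1
    · subst h
      exact hFg.differentiableAt_iff.2 hg.differentiableAt.neg
    · have : F =ᶠ[𝓝 z] fun z => (1 - z) • Ring.inverse (arOperator a z) := by
        filter_upwards [isOpen_ne.mem_nhds h] with w hw using hFne w hw
      refine this.differentiableAt_iff.2 ?_
      have h₁ : DifferentiableAt ℂ (fun z : ℂ => 1 - z) z := by fun_prop
      exact h₁.smul
        ((differentiableAt_inverse (hinv z hz h)).comp z (differentiable_arOperator a z))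
  have h1 : (1 : ℂ) ∈ Metric.ball (0 : ℂ) ρ := by simpa using hρ
  -- At `z = 1` both product identities are obtained as limits from the punctured disc.
  have hF1 : Tendsto F (𝓝[≠] 1) (𝓝 (F 1)) :=
    (hdiff.continuousOn.continuousAt (Metric.isOpen_ball.mem_nhds h1)).tendsto.mono_left
      nhdsWithin_le_nhds
  have hA1 : Tendsto (arOperator a) (𝓝[≠] 1) (𝓝 (arOperator a 1)) :=
    (differentiable_arOperator a).continuous.continuousAt.tendsto.mono_left nhdsWithin_le_nhds
  have hsm : Tendsto (fun z : ℂ => (1 - z) • (1 : H →L[ℂ] H)) (𝓝[≠] 1)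
      (𝓝 ((1 - 1 : ℂ) • (1 : H →L[ℂ] H))) := by
    refine Tendsto.mono_left (Continuous.tendsto ?_ _) nhdsWithin_le_nhds
    fun_prop
  have hball : ∀ᶠ z : ℂ in 𝓝[≠] 1, z ∈ Metric.ball (0 : ℂ) ρ ∧ z ≠ 1 :=
    (eventually_nhdsWithin_of_eventually_nhds (Metric.isOpen_ball.mem_nhds h1)).and
      self_mem_nhdsWithin
  have hl : ∀ z ∈ Metric.ball (0 : ℂ) ρ, z ≠ 1 → arOperator a z * F z = (1 - z) • 1 := by
    intro z hz h
    rw [hFne z h, mul_smul_comm, Ring.mul_inverse_cancel _ (hinv z hz h)]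
  have hr : ∀ z ∈ Metric.ball (0 : ℂ) ρ, z ≠ 1 → F z * arOperator a z = (1 - z) • 1 := by
    intro z hz h
    rw [hFne z h, smul_mul_assoc, Ring.inverse_mul_cancel _ (hinv z hz h)]
  refine ⟨F, hdiff, by simpa [hF] using hg1, fun z hz => ?_, fun z hz => ?_⟩
  · by_cases h : z = 1
    · subst h
      refine tendsto_nhds_unique ((hA1.mul hF1).congr' ?_) hsm
      filter_upwards [hball] with z hz using hl z hz.1 hz.2
    · exact hl z hz h
  · by_cases h : z = 1
    · subst h
      refine tendsto_nhds_unique ((hF1.mul hA1).congr' ?_) hsm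
      filter_upwards [hball] with z hz using hr z hz.1 hz.2
    · exact hr z hz h

/-- Two power series with the same sum near zero have the same coefficients. -/
lemma coeff_unique {E : Type*} [NormedAddCommGroup E] [NormedSpace ℂ E] {b c : ℕ → E}
    {f : ℂ → E}
    (hb : ∀ᶠ z : ℂ in 𝓝 0, HasSum (fun n => z ^ n • b n) (f z))
    (hc : ∀ᶠ z : ℂ in 𝓝 0, HasSum (fun n => z ^ n • c n) (f z)) : b = c := by
  let p : (ℕ → E) → FormalMultilinearSeries ℂ ℂ E := fun b n =>
    ContinuousMultilinearMap.mkPiRing ℂ (Fin n) (b n)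
  have hp : ∀ b n, (p b).coeff n = b n := fun b n => by simp [p, FormalMultilinearSeries.coeff]
  have key : ∀ {b : ℕ → E}, (∀ᶠ z : ℂ in 𝓝 0, HasSum (fun n => z ^ n • b n) (f z)) →
      HasFPowerSeriesAt f (p b) 0 := by
    intro b hb
    rw [hasFPowerSeriesAt_iff]
    simpa [hp] using hb
  have := (key hb).eq_formalMultilinearSeries (key hc)
  funext n
  have h := congrArg (fun p : FormalMultilinearSeries ℂ ℂ E => p.coeff n) this
  simpa [hp] using h

/-- The power series of a holomorphic function on a disc converges absolutely. -/
lemma exists_powerSeries {E : Type*} [NormedAddCommGroup E] [NormedSpace ℂ E] [CompleteSpace E]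
    {F : ℂ → E} {ρ : ℝ} (hρ : 0 < ρ) (hF : DifferentiableOn ℂ F (Metric.ball 0 ρ)) :
    ∃ b : ℕ → E, (∀ z ∈ Metric.ball (0 : ℂ) ρ, Summable fun n : ℕ => ‖b n‖ * ‖z‖ ^ n) ∧
      ∀ z ∈ Metric.ball (0 : ℂ) ρ, HasSum (fun n => z ^ n • b n) (F z) := by
  have hmain : ∀ r : NNReal, 0 < r → (r : ℝ) < ρ →
      HasFPowerSeriesOnBall F (cauchyPowerSeries F 0 r) 0 r := by
    intro r hr hrρ
    refine DifferentiableOn.hasFPowerSeriesOnBall (hF.mono ?_) hr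
    exact Metric.closedBall_subset_ball hrρ
  obtain ⟨r₀, hr₀pos, hr₀lt⟩ : ∃ r₀ : NNReal, 0 < r₀ ∧ (r₀ : ℝ) < ρ := by
    obtain ⟨r, hr, hrρ⟩ := exists_between hρ
    exact ⟨⟨r, hr.le⟩, hr, hrρ⟩
  have h₀ := hmain r₀ hr₀pos hr₀lt
  set p := cauchyPowerSeries F 0 r₀ with hp
  -- The Cauchy series at different radii agree by uniqueness, so a single series serves the whole
  -- disc.
  have hall : ∀ r : NNReal, 0 < r → (r : ℝ) < ρ → HasFPowerSeriesOnBall F p 0 r := by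
    intro r hr hrρ
    have := hmain r hr hrρ
    rwa [this.hasFPowerSeriesAt.eq_formalMultilinearSeries h₀.hasFPowerSeriesAt] at this
  refine ⟨fun n => p.coeff n, fun z hz => ?_, fun z hz => ?_⟩
  all_goals
    rw [mem_ball_zero_iff] at hz
    obtain ⟨r, hzr, hrρ⟩ := exists_between hz
    lift r to NNReal using (norm_nonneg z).trans hzr.le
    have hr := hall r (NNReal.coe_pos.1 ((norm_nonneg z).trans_lt hzr)) hrρ
  · have h := p.summable_norm_mul_pow (r := ‖z‖₊)
      (lt_of_lt_of_le (by exact_mod_cast hzr) hr.r_le)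
    simpa [FormalMultilinearSeries.norm_apply_eq_norm_coef] using h
  · have h := hr.hasSum (y := z) (by simpa [enorm_eq_nnnorm] using hzr)
    simpa using h

/-- The coefficients of `(1 - z) A(z)⁻¹`. -/
theorem exists_seriesInverse [CompleteSpace H] {k : ℕ} {a : Fin k → H →L[ℂ] H}
    (hU : IsUnitRootOfFiniteType a) (hd : HasPoleOfOrder a 1) :
    ∃ B : ℕ → H →L[ℂ] H,
      (∃ ρ : ℝ, 1 < ρ ∧ ∀ z ∈ Metric.ball (0 : ℂ) ρ, Summable fun n : ℕ => ‖B n‖ * ‖z‖ ^ n) ∧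
      (∑' n, B n) ≠ 0 ∧ arOperator a 1 * (∑' n, B n) = 0 ∧
      ∀ n : ℕ, ∑ p ∈ Finset.HasAntidiagonal.antidiagonal n, B p.1 * arCoeff a p.2 =
        (if n = 0 then 1 else 0) - (if n = 1 then 1 else 0) := by
  obtain ⟨ρ, hρ, hinv⟩ := hU.invertible
  obtain ⟨F, hF, hF1, hl, hr⟩ := exists_holomorphic_extension hρ hinv hd
  obtain ⟨B, hB, hBF⟩ := exists_powerSeries (by linarith) hF
  have h1 : (1 : ℂ) ∈ Metric.ball (0 : ℂ) ρ := by simpa using hρ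
  have hsum1 : ∑' n, B n = F 1 := by simpa using (hBF 1 h1).tsum_eq
  refine ⟨B, ⟨ρ, hρ, hB⟩, by rwa [hsum1], by simpa [hsum1] using hl 1 h1, fun n => ?_⟩
  have hA : ∀ z : ℂ, HasSum (fun j => z ^ j • arCoeff a j) (arOperator a z) := by
    intro z
    rw [arOperator_eq_sum]
    apply hasSum_sum_of_ne_finset_zero
    intro j hj
    rw [arCoeff_eq_zero a (by simpa using hj), smul_zero]
  -- The Cauchy product of `B` with the coefficients of `A` sums to `F(z) A(z) = (1 - z) • 1`. The
  -- order `B` before `A` matters: `B(L)` will be applied to `A(L) x`.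
  refine congrFun (coeff_unique (f := fun z => (1 - z) • (1 : H →L[ℂ] H))
    (b := fun n : ℕ =>
      ∑ p ∈ Finset.HasAntidiagonal.antidiagonal n, B p.1 * arCoeff a p.2)
    (c := fun n : ℕ => (if n = 0 then 1 else 0) - (if n = 1 then 1 else 0)) ?_ ?_) n
  · filter_upwards [Metric.ball_mem_nhds (0 : ℂ) (show 0 < ρ by linarith)] with z hz
    have hs1 : Summable fun n => ‖z ^ n • B n‖ := by
      simpa [norm_smul, mul_comm] using hB z hz
    have hs2 : Summable fun n => ‖z ^ n • arCoeff a n‖ := by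
      refine summable_of_ne_finset_zero (s := Finset.range (k + 1)) fun j hj => ?_
      rw [arCoeff_eq_zero a (by simpa using hj), smul_zero, norm_zero]
    have hprod := tsum_mul_tsum_eq_tsum_sum_antidiagonal_of_summable_norm hs1 hs2
    have hsm := (summable_norm_sum_mul_antidiagonal_of_summable_norm hs1 hs2).of_norm.hasSum
    rw [← hprod, (hBF z hz).tsum_eq, (hA z).tsum_eq, hr z hz] at hsm
    refine hsm.congr_fun fun n => ?_
    rw [Finset.smul_sum]
    refine Finset.sum_congr rfl fun p hp => ?_
    rw [smul_mul_smul_comm, ← pow_add, Finset.HasAntidiagonal.mem_antidiagonal.1 hp]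
  · refine Eventually.of_forall fun z => ?_
    have h0 : HasSum (fun n : ℕ => z ^ n • (if n = 0 then (1 : H →L[ℂ] H) else 0)) 1 := by
      convert! hasSum_ite_eq (0 : ℕ) (1 : H →L[ℂ] H) using 2 with n
      split_ifs with h <;> simp [h]
    have h1 : HasSum (fun n : ℕ => z ^ n • (if n = 1 then (1 : H →L[ℂ] H) else 0)) (z • 1) := by
      convert! hasSum_ite_eq (1 : ℕ) (z • (1 : H →L[ℂ] H)) using 2 with n
      split_ifs with h <;> simp [h]
    simpa [sub_smul, smul_sub] using h0.sub h1

end SeriesInverse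

/-! ### Second moments from scalar covariances -/

section SecondMoments

variable {H : Type*} [NormedAddCommGroup H] [InnerProductSpace ℂ H]

/-- Distinct basis vectors are at distance `√2`, so the balls of radius `1/2` around them are
disjoint, and a separable space has only countably many disjoint nonempty open sets. -/
lemma HilbertBasis.countable_index [TopologicalSpace.SeparableSpace H] {ι : Type*}
    (b : HilbertBasis ι ℂ H) : Countable ι := by
  have hdist : ∀ i j, i ≠ j → (1 : ℝ) < dist (b i) (b j) := by
    intro i j hij
    have h := norm_sub_sq (𝕜 := ℂ) (b i) (b j)
    rw [b.orthonormal.1 i, b.orthonormal.1 j, b.orthonormal.2 hij] at h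
    rw [dist_eq_norm]
    simp only [map_zero] at h
    nlinarith [norm_nonneg (b i - b j)]
  have : Set.PairwiseDisjoint Set.univ fun i => Metric.ball (b i) (1 / 2) := by
    intro i _ j _ hij
    apply Metric.ball_disjoint_ball
    linarith [hdist i j hij]
  exact Set.countable_univ_iff.1
    (this.countable_of_isOpen (fun i _ => Metric.isOpen_ball) fun i _ => by simp)

/-- Parseval's identity, in extended nonnegative form so that the sum can be exchanged with an
integral freely. -/
lemma HilbertBasis.tsum_enorm_inner_sq {ι : Type*} (b : HilbertBasis ι ℂ H) (x : H) :
    ∑' i, ‖inner ℂ (b i) x‖ₑ ^ 2 = ‖x‖ₑ ^ 2 := by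
  have h := (b.hasSum_inner_mul_inner x x).mapL Complex.reCLM
  have h2 : HasSum (fun i => ‖inner ℂ (b i) x‖ ^ 2) (‖x‖ ^ 2) := by
    convert! h using 1
    · funext i
      rw [Complex.reCLM_apply, ← inner_conj_symm x (b i), ← Complex.normSq_eq_conj_mul_self,
        Complex.ofReal_re, Complex.normSq_eq_norm_sq]
    · rw [Complex.reCLM_apply, inner_self_eq_norm_sq_to_K]
      norm_cast
  have h3 := ENNReal.ofReal_tsum_of_nonneg (fun i => by positivity) h2.summable
  rw [h2.tsum_eq] at h3
  simpa [ENNReal.ofReal_pow, ofReal_norm] using h3.symm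

variable {Ω : Type*} [MeasurableSpace Ω] {P : Measure Ω}

lemma lintegral_enorm_sq {E : Type*} [NormedAddCommGroup E] (X : Ω → E) :
    ∫⁻ ω, ‖X ω‖ₑ ^ 2 ∂P = eLpNorm X 2 P ^ 2 := by
  rw [eLpNorm_eq_lintegral_rpow_enorm_toReal (by norm_num) (by norm_num)]
  rw [← ENNReal.rpow_natCast, ← ENNReal.rpow_mul]
  simp

lemma lintegral_enorm_inner_sq [CompleteSpace H] {X : Ω → H} (hX : MemLp X 2 P)
    (hX0 : ∫ ω, X ω ∂P = 0) (v : H) :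
    ∫⁻ ω, ‖inner ℂ v (X ω)‖ₑ ^ 2 ∂P = ENNReal.ofReal (crossCov P X X v v).re := by
  have hI : MemLp (fun ω => inner ℂ v (X ω)) 2 P := hX.const_inner v
  have : ∀ ω, inner ℂ v (X ω) * (starRingEnd ℂ) (inner ℂ v (X ω)) =
      ((‖inner ℂ v (X ω)‖ ^ 2 : ℝ) : ℂ) := fun ω => by
    rw [Complex.mul_conj, Complex.normSq_eq_norm_sq]
  simp only [crossCov, hX0, sub_zero, this]
  rw [integral_complex_ofReal, Complex.ofReal_re,
    ofReal_integral_eq_lintegral_ofReal (hI.integrable_norm_pow (by norm_num))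
      (Eventually.of_forall fun ω => by positivity)]
  simp [ENNReal.ofReal_pow]

/-- The second moment of a centred variable is determined by its covariances. -/
lemma eLpNorm_eq_of_crossCov_eq [CompleteSpace H] [TopologicalSpace.SeparableSpace H]
    {X Y : Ω → H} (hX : MemLp X 2 P) (hY : MemLp Y 2 P) (hX0 : ∫ ω, X ω ∂P = 0) (hY0 : ∫ ω, Y ω ∂P = 0)
    (h : ∀ v, crossCov P X X v v = crossCov P Y Y v v) : eLpNorm X 2 P = eLpNorm Y 2 P := by
  obtain ⟨w, b, -⟩ := exists_hilbertBasis ℂ H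
  have := b.countable_index
  have key : ∀ {X : Ω → H}, MemLp X 2 P → ∫ ω, X ω ∂P = 0 →
      eLpNorm X 2 P ^ 2 = ∑' i, ENNReal.ofReal (crossCov P X X (b i) (b i)).re := by
    intro X hX hX0
    simp_rw [← lintegral_enorm_sq, ← b.tsum_enorm_inner_sq]
    rw [lintegral_tsum fun i => ?_]
    · simp_rw [lintegral_enorm_inner_sq hX hX0]
    · exact ((hX.const_inner (b i)).aestronglyMeasurable.enorm).pow_const 2
  refine (ENNReal.pow_right_strictMono two_ne_zero).injective ?_
  simp only [key hX hX0, key hY hY0, h]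

/-- Stationarity constrains only scalar covariances; summing them over a countable Hilbert basis
recovers the full second moment. This supplies every uniform-in-time `L²` bound on white noise
below. -/
lemma IsWhiteNoise.eLpNorm_eq [CompleteSpace H] [TopologicalSpace.SeparableSpace H]
    [MeasurableSpace H] {ε : ℤ → Ω → H} (hε : IsWhiteNoise P ε) (t : ℤ) :
    eLpNorm (ε t) 2 P = eLpNorm (ε 0) 2 P :=
  eLpNorm_eq_of_crossCov_eq (hε.weaklyStationary.memLp t) (hε.weaklyStationary.memLp 0)
    (hε.mean_zero t) (hε.mean_zero 0) fun v => by
      simpa using (hε.weaklyStationary.cov_shift 0 0 t v v).symm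

end SecondMoments

/-! ### Absolutely convergent series in `L²` -/

section LinearFilters

variable {Ω : Type*} [MeasurableSpace Ω] {H : Type*} [NormedAddCommGroup H]
  {P : Measure Ω}

/-- A series which is absolutely convergent in `L²` converges absolutely almost surely. -/
lemma ae_summable_norm_of_tsum_eLpNorm_ne_top [IsProbabilityMeasure P] {f : ℕ → Ω → H}
    (hf : ∀ n, AEStronglyMeasurable (f n) P) (h : ∑' n, eLpNorm (f n) 2 P ≠ ⊤) :
    ∀ᵐ ω ∂P, Summable fun n => ‖f n ω‖ := by
  have h1 : ∫⁻ ω, ∑' n, ‖f n ω‖ₑ ∂P ≠ ⊤ := by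
    rw [lintegral_tsum fun n => (hf n).enorm]
    refine ne_top_of_le_ne_top h (ENNReal.tsum_le_tsum fun n => ?_)
    rw [← eLpNorm_one_eq_lintegral_enorm]
    exact eLpNorm_le_eLpNorm_of_exponent_le (by norm_num) (hf n)
  filter_upwards [ae_lt_top' (AEMeasurable.tsum fun n => (hf n).enorm) h1] with ω hω
  have := ENNReal.summable_toReal hω.ne
  simpa using this

/-- A series which is absolutely convergent in `L²` and whose partial sums converge almost surely to
`u` converges to `u` in `L²`. -/
lemma tendsto_eLpNorm_sub_sum {f : ℕ → Ω → H} {u : Ω → H}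
    (hf : ∀ n, AEStronglyMeasurable (f n) P) (h : ∑' n, eLpNorm (f n) 2 P ≠ ⊤)
    (hu : ∀ᵐ ω ∂P, HasSum (fun n => f n ω) (u ω)) :
    Tendsto (fun N : ℕ => eLpNorm (fun ω => u ω - ∑ n ∈ Finset.range N, f n ω) 2 P)
      atTop (𝓝 0) := by
  refine tendsto_of_tendsto_of_tendsto_of_le_of_le tendsto_const_nhds
    (ENNReal.tendsto_sum_nat_add _ h) (fun _ => zero_le) fun N => ?_
  have hS : ∀ M, AEStronglyMeasurable (fun ω => ∑ n ∈ Finset.range M, f (n + N) ω) P := fun M =>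
    Finset.aestronglyMeasurable_fun_sum _ fun n _ => hf (n + N)
  -- Fatou's lemma: the remainder after `N` terms is the almost sure limit of finite blocks, each
  -- bounded by the tail of the series of norms.
  refine (Lp.eLpNorm_lim_le_liminf_eLpNorm hS _ ?_).trans ?_
  · filter_upwards [hu] with ω hω
    exact ((hasSum_nat_add_iff' N).2 hω).tendsto_sum_nat
  · refine liminf_le_of_le (by isBoundedDefault) fun b hb => ?_
    obtain ⟨M, hM⟩ := hb.exists
    refine hM.trans ?_
    have h1 := eLpNorm_sum_le (p := 2) (μ := P) (s := Finset.range M)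
      (f := fun n => f (n + N)) (fun n _ => hf (n + N)) (by norm_num)
    have h2 : (∑ n ∈ Finset.range M, f (n + N)) = fun ω => ∑ n ∈ Finset.range M, f (n + N) ω := by
      funext ω
      simp
    rw [h2] at h1
    exact h1.trans (ENNReal.sum_le_tsum _)

end LinearFilters

/-! ### Truncated inversion of the autoregression -/

section Remainder

variable {H : Type*} [NormedAddCommGroup H] [InnerProductSpace ℂ H]

/-- Applying the truncated series `∑_{n < N} B_n L^n` to `A(L) x` gives `x_t - x_{t-1}` up to terms
in `x_{t-m}` with `m ≥ N`. -/
lemma sum_apply_ar_eq {k : ℕ} {a : Fin k → H →L[ℂ] H} {B : ℕ → H →L[ℂ] H}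
    (hBA : ∀ n : ℕ, ∑ p ∈ Finset.HasAntidiagonal.antidiagonal n, B p.1 * arCoeff a p.2 =
      (if n = 0 then 1 else 0) - (if n = 1 then 1 else 0))
    {N : ℕ} (hN : 2 ≤ N) (x : ℕ → H) :
    ∑ n ∈ Finset.range N, B n (∑ j ∈ Finset.range (k + 1), arCoeff a j (x (n + j))) =
      x 0 - x 1 + ∑ p ∈ (Finset.range N ×ˢ Finset.range (k + 1)) with N ≤ p.1 + p.2,
        B p.1 (arCoeff a p.2 (x (p.1 + p.2))) := by
  simp_rw [map_sum]
  rw [← Finset.sum_product' (f := fun n j => B n (arCoeff a j (x (n + j)))),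
    ← Finset.sum_filter_not_add_sum_filter _ (fun p : ℕ × ℕ => N ≤ p.1 + p.2)]
  congr 1
  rw [← Finset.sum_fiberwise_of_maps_to (t := Finset.range N) (g := fun p : ℕ × ℕ => p.1 + p.2)
    (fun p hp => by simpa using (Finset.mem_filter.1 hp).2)]
  -- For `m < N` the fibre contains every antidiagonal pair except those with second index above
  -- `k`, where the coefficient of `A` vanishes. So `x m` is multiplied by the `m`-th coefficient of
  -- `1 - z`; `2 ≤ N` ensures that both nonzero ones occur.
  have hfib : ∀ m ∈ Finset.range N,
      ∑ p ∈ {p ∈ Finset.range N ×ˢ Finset.range (k + 1) | ¬ N ≤ p.1 + p.2} with p.1 + p.2 = m,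
        B p.1 (arCoeff a p.2 (x (p.1 + p.2))) =
      ((if m = 0 then 1 else 0) - (if m = 1 then 1 else 0) : H →L[ℂ] H) (x m) := by
    intro m hm
    rw [← hBA m, sum_apply]
    refine Finset.sum_subset_zero_on_sdiff (fun p hp => ?_) (fun p hp => ?_) (fun p hp => ?_)
    · simpa using (Finset.mem_filter.1 hp).2
    · simp only [Finset.mem_sdiff, Finset.HasAntidiagonal.mem_antidiagonal, Finset.mem_filter, Finset.mem_product,
        Finset.mem_range] at hp hm
      rw [arCoeff_eq_zero a (by omega), mul_zero, zero_apply]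
    · rw [(Finset.mem_filter.1 hp).2]
      rfl
  rw [Finset.sum_congr rfl hfib]
  simp only [sub_apply, Finset.sum_sub_distrib]
  congr 1
  · rw [Finset.sum_eq_single_of_mem 0 (by simp; omega)] <;> simp +contextual
  · rw [Finset.sum_eq_single_of_mem 1 (by simp; omega)] <;> simp +contextual

end Remainder

/-! ### Moving average representation of the solution -/

section Representation

/-- Finitely many sequences converging in measure converge almost surely along a common
subsequence. -/
lemma exists_common_seq_tendsto_ae {Ω E ι : Type*} [MeasurableSpace Ω] {P : Measure Ω}
    [PseudoEMetricSpace E] {f : ι → ℕ → Ω → E} {g : ι → Ω → E} (s : Finset ι)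
    (h : ∀ i ∈ s, TendstoInMeasure P (f i) atTop (g i)) :
    ∃ ns : ℕ → ℕ, StrictMono ns ∧
      ∀ᵐ ω ∂P, ∀ i ∈ s, Tendsto (fun n => f i (ns n) ω) atTop (𝓝 (g i ω)) := by
  classical
  induction s using Finset.induction_on with
  | empty => exact ⟨id, strictMono_id, by simp⟩
  | insert a s _ ih =>
    obtain ⟨ns, hns, hs⟩ := ih fun i hi => h i (Finset.mem_insert_of_mem hi)
    obtain ⟨ms, hms, ha⟩ :=
      ((h a (Finset.mem_insert_self a s)).comp hns.tendsto_atTop).exists_seq_tendsto_ae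
    refine ⟨ns ∘ ms, hns.comp hms, ?_⟩
    filter_upwards [hs, ha] with ω h1 h2 i hi
    rcases Finset.mem_insert.1 hi with rfl | hi
    · exact h2
    · exact (h1 i hi).comp hms.tendsto_atTop

/-- The remainder involves several neighbouring times at once, and convergence in probability gives
almost sure convergence only along a subsequence, which must be common to all of them. -/
lemma HasSubexponentialPast.exists_seq_tendsto {H Ω : Type*} [NormedAddCommGroup H]
    [MeasurableSpace Ω] {P : Measure Ω} {x : ℤ → Ω → H} (hx : HasSubexponentialPast P x)
    {r : ℝ} (hr0 : 0 < r) (hr1 : r < 1) (t : ℤ) (K : ℕ) :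
    ∃ ns : ℕ → ℕ, StrictMono ns ∧ ∀ᵐ ω ∂P, ∀ i ∈ Finset.range K,
      Tendsto (fun n => r ^ ns n * ‖x (t - ((ns n + i : ℕ) : ℤ)) ω‖) atTop (𝓝 0) := by
  -- Time `t - (N + i)` is `-(N + i - t)`. Truncation by `toNat` is harmless for large `N`, and the
  -- shift changes the weight only by the constant `r ^ (t - i)`.
  have hm : ∀ i : ℕ, Tendsto (fun N : ℕ => ((N : ℤ) + i - t).toNat) atTop atTop := fun i => by
    refine tendsto_atTop.2 fun b => ?_
    filter_upwards [eventually_ge_atTop (b + t.toNat)] with N hN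
    omega
  obtain ⟨ns, hns, h⟩ := exists_common_seq_tendsto_ae (Finset.range K)
    fun i _ => (hx r hr0 hr1).comp (hm i)
  refine ⟨ns, hns, ?_⟩
  filter_upwards [h] with ω hω i hi
  have h1 := (hω i hi).const_mul (r ^ (t - i))
  rw [mul_zero] at h1
  refine h1.congr' ?_
  filter_upwards [hns.tendsto_atTop.eventually_ge_atTop t.toNat] with n hn
  have h2 : ((((ns n : ℤ) + i - t).toNat : ℕ) : ℤ) = ns n + i - t := by omega
  simp only [Function.comp_apply]
  rw [← mul_assoc, ← zpow_natCast, ← zpow_add₀ hr0.ne', h2, ← zpow_natCast]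
  congr 2
  · ring
  · congr 2
    push_cast
    ring

variable {H : Type*} [NormedAddCommGroup H] [InnerProductSpace ℂ H] {Ω : Type*}
  [MeasurableSpace Ω] {P : Measure Ω}

/-- The remainder in the truncated inversion of an autoregression is negligible. -/
lemma norm_ar_remainder_le {k : ℕ} (a : Fin k → H →L[ℂ] H) {B : ℕ → H →L[ℂ] H} {C r : ℝ}
    (hr0 : 0 < r) (hr1 : r < 1) (hB : ∀ n, ‖B n‖ ≤ C * r ^ n) :
    ∃ D : ℝ, ∀ (N : ℕ) (x : ℕ → H),
      ‖∑ p ∈ Finset.range N ×ˢ Finset.range (k + 1) with N ≤ p.1 + p.2,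
        B p.1 (arCoeff a p.2 (x (p.1 + p.2)))‖ ≤
      D * ∑ i ∈ Finset.range (k + 1), r ^ N * ‖x (N + i)‖ := by
  set K : ℝ := ∑ j ∈ Finset.range (k + 1), ‖arCoeff a j‖ with hK
  have hC : 0 ≤ C := by simpa using (norm_nonneg _).trans (hB 0)
  have hK0 : 0 ≤ K := Finset.sum_nonneg fun _ _ => norm_nonneg _
  -- A pair `(n, j)` is determined by `(j, n + j - N)`, so there are at most `(k + 1)²` terms. Each
  -- has `n ≥ N - k`, whence `r ^ n ≤ (r ^ k)⁻¹ * r ^ N`.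
  refine ⟨((k + 1) * (k + 1) : ℕ) * (C * K * (r ^ k)⁻¹), fun N x => ?_⟩
  set S := ∑ i ∈ Finset.range (k + 1), r ^ N * ‖x (N + i)‖ with hS
  have hS0 : 0 ≤ S := Finset.sum_nonneg fun _ _ => by positivity
  set s := {p ∈ Finset.range N ×ˢ Finset.range (k + 1) | N ≤ p.1 + p.2} with hs
  have hmem : ∀ p ∈ s, p.1 < N ∧ p.2 < k + 1 ∧ N ≤ p.1 + p.2 := fun p hp => by
    simpa [hs, and_assoc] using hp
  have hterm : ∀ p ∈ s, ‖B p.1 (arCoeff a p.2 (x (p.1 + p.2)))‖ ≤ C * K * (r ^ k)⁻¹ * S := by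
    intro p hp
    obtain ⟨h1, h2, h3⟩ := hmem p hp
    have hxS : r ^ N * ‖x (p.1 + p.2)‖ ≤ S := by
      have := Finset.single_le_sum (f := fun i => r ^ N * ‖x (N + i)‖)
        (fun i _ => by positivity) (Finset.mem_range.2 (show p.1 + p.2 - N < k + 1 by omega))
      rwa [Nat.add_sub_cancel' h3] at this
    have hrN : r ^ p.1 ≤ (r ^ k)⁻¹ * r ^ N := by
      rw [inv_mul_eq_div, le_div_iff₀ (by positivity), ← pow_add]
      exact pow_le_pow_of_le_one hr0.le hr1.le (by omega)
    have haK : ‖arCoeff a p.2‖ ≤ K :=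
      Finset.single_le_sum (f := fun j => ‖arCoeff a j‖) (fun _ _ => norm_nonneg _)
        (Finset.mem_range.2 h2)
    calc ‖B p.1 (arCoeff a p.2 (x (p.1 + p.2)))‖
        ≤ ‖B p.1‖ * (‖arCoeff a p.2‖ * ‖x (p.1 + p.2)‖) :=
          (B p.1).le_opNorm_of_le ((arCoeff a p.2).le_opNorm _)
      _ ≤ (C * ((r ^ k)⁻¹ * r ^ N)) * (K * ‖x (p.1 + p.2)‖) := by
          gcongr
          exact (hB _).trans (by gcongr)
      _ = C * K * (r ^ k)⁻¹ * (r ^ N * ‖x (p.1 + p.2)‖) := by ring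
      _ ≤ C * K * (r ^ k)⁻¹ * S := by gcongr
  have hcard : s.card ≤ (k + 1) * (k + 1) := by
    rw [← Finset.card_range (k + 1), ← Finset.card_product]
    refine Finset.card_le_card_of_injOn (fun p => (p.2, p.1 + p.2 - N)) (fun p hp => ?_) ?_
    · obtain ⟨h1, h2, h3⟩ := hmem p hp
      simp only [Finset.coe_product, Finset.coe_range, Set.mem_prod, Set.mem_Iio]
      omega
    · intro p hp q hq hpq
      obtain ⟨h1, h2, h3⟩ := hmem p hp
      obtain ⟨h4, h5, h6⟩ := hmem q hq
      simp only [Prod.mk.injEq] at hpq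
      ext <;> omega
  calc _ ≤ ∑ _p ∈ s, C * K * (r ^ k)⁻¹ * S := norm_sum_le_of_le s hterm
    _ = s.card * (C * K * (r ^ k)⁻¹ * S) := by rw [Finset.sum_const, nsmul_eq_mul]
    _ ≤ ((k + 1) * (k + 1) : ℕ) * (C * K * (r ^ k)⁻¹ * S) := by gcongr
    _ = _ := by ring

variable [CompleteSpace H]

/-- A solution of an autoregression with subexponential past is recovered from the noise by the
series inverse. -/
lemma ae_hasSum_diffProcess {k : ℕ} {a : Fin k → H →L[ℂ] H} {B : ℕ → H →L[ℂ] H} {C r : ℝ}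
    (hr0 : 0 < r) (hr1 : r < 1) (hB : ∀ n, ‖B n‖ ≤ C * r ^ n)
    (hBA : ∀ n : ℕ, ∑ p ∈ Finset.HasAntidiagonal.antidiagonal n, B p.1 * arCoeff a p.2 =
      (if n = 0 then 1 else 0) - (if n = 1 then 1 else 0))
    {x ε : ℤ → Ω → H} (hx : SolvesAR P a x ε) (hpast : HasSubexponentialPast P x) (t : ℤ)
    (hsum : ∀ᵐ ω ∂P, Summable fun n : ℕ => ‖B n (ε (t - n) ω)‖) :
    ∀ᵐ ω ∂P, HasSum (fun n : ℕ => B n (ε (t - n) ω)) (diffProcess x t ω) := by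
  obtain ⟨ns, hns, hlim⟩ := hpast.exists_seq_tendsto hr0 hr1 t (k + 1)
  obtain ⟨D, hD⟩ := norm_ar_remainder_le a hr0 hr1 hB
  filter_upwards [hsum, hlim, ae_all_iff.2 hx] with ω hω hωlim hωx
  have hε : ∀ n : ℕ, ε (t - n) ω =
      ∑ j ∈ Finset.range (k + 1), arCoeff a j (x (t - ((n + j : ℕ) : ℤ)) ω) := by
    intro n
    have h1 := sum_arCoeff a fun j =>
      ((ContinuousLinearMap.apply ℂ H (x (t - ((n + j : ℕ) : ℤ)) ω)) :
        (H →L[ℂ] H) →ₗ[ℂ] H).toAddMonoidHom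
    have h2 := hωx (t - n)
    simp only [LinearMap.toAddMonoidHom_coe, ContinuousLinearMap.coe_coe,
      ContinuousLinearMap.apply_apply] at h1
    rw [h1, eq_sub_iff_add_eq, add_comm]
    simp only [add_zero, one_apply_eq_self]
    rw [h2]
    congr 1
    refine Finset.sum_congr rfl fun h _ => ?_
    congr 2
    push_cast
    ring
  have hsub : Tendsto (fun n => ∑ m ∈ Finset.range (ns n), B m (ε (t - m) ω)) atTop
      (𝓝 (diffProcess x t ω)) := by
    have hrem : Tendsto (fun n => ∑ p ∈ Finset.range (ns n) ×ˢ Finset.range (k + 1)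
        with ns n ≤ p.1 + p.2, B p.1 (arCoeff a p.2 (x (t - ((p.1 + p.2 : ℕ) : ℤ)) ω)))
        atTop (𝓝 0) := by
      have h0 : Tendsto (fun n => D * ∑ i ∈ Finset.range (k + 1),
          r ^ ns n * ‖x (t - ((ns n + i : ℕ) : ℤ)) ω‖) atTop (𝓝 0) := by
        simpa using (tendsto_finsetSum _ hωlim).const_mul D
      exact squeeze_zero_norm (fun n => hD (ns n) fun m => x (t - (m : ℤ)) ω) h0
    have h1 := hrem.const_add (diffProcess x t ω)
    rw [add_zero] at h1
    refine h1.congr' ?_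
    filter_upwards [hns.tendsto_atTop.eventually_ge_atTop 2] with n hn
    simp_rw [hε]
    rw [sum_apply_ar_eq hBA hn fun m => x (t - (m : ℤ)) ω]
    simp [diffProcess]
  -- The series is already known to converge, so its limit along one subsequence of partial sums
  -- determines the sum.
  have h := hω.of_norm.hasSum
  rwa [tendsto_nhds_unique (h.tendsto_sum_nat.comp hns.tendsto_atTop) hsub] at h

/-- Geometric decay of the coefficients of a power series converging beyond the unit disc. -/
lemma exists_geometric_bound {E : Type*} [NormedAddCommGroup E] {B : ℕ → E} {ρ : ℝ} (hρ : 1 < ρ)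
    (hB : ∀ z ∈ Metric.ball (0 : ℂ) ρ, Summable fun n : ℕ => ‖B n‖ * ‖z‖ ^ n) :
    ∃ C r : ℝ, 0 < r ∧ r < 1 ∧ ∀ n, ‖B n‖ ≤ C * r ^ n := by
  obtain ⟨R, hR1, hRρ⟩ := exists_between hρ
  have hR0 : 0 < R := by linarith
  have hs := hB (R : ℂ) (by simpa [abs_of_pos hR0] using hRρ)
  simp only [Complex.norm_real, Real.norm_eq_abs, abs_of_pos hR0] at hs
  refine ⟨∑' n, ‖B n‖ * R ^ n, R⁻¹, by positivity, inv_lt_one_of_one_lt₀ hR1, fun n => ?_⟩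
  rw [inv_pow, ← div_eq_mul_inv, le_div_iff₀ (by positivity)]
  exact hs.le_tsum n fun m _ => by positivity

variable [TopologicalSpace.SeparableSpace H] [MeasurableSpace H]

/-- All noise variables share one `L²` norm, so the terms are dominated by a multiple of `‖B n‖`. -/
lemma IsWhiteNoise.tsum_eLpNorm_ne_top {ε : ℤ → Ω → H} (hε : IsWhiteNoise P ε)
    {B : ℕ → H →L[ℂ] H} (hB : Summable fun n => ‖B n‖) (t : ℤ) :
    ∑' n : ℕ, eLpNorm (fun ω => B n (ε (t - n) ω)) 2 P ≠ ⊤ := by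
  have hle : ∀ n : ℕ, eLpNorm (fun ω => B n (ε (t - n) ω)) 2 P ≤
      ENNReal.ofReal ‖B n‖ * eLpNorm (ε 0) 2 P := fun n => by
    rw [← hε.eLpNorm_eq (t - n)]
    exact eLpNorm_le_mul_eLpNorm_of_ae_le_mul
      (Eventually.of_forall fun ω => (B n).le_opNorm _) 2
  refine ne_top_of_le_ne_top ?_ (ENNReal.tsum_le_tsum hle)
  rw [ENNReal.tsum_mul_right]
  exact ENNReal.mul_ne_top hB.tsum_ofReal_ne_top (hε.weaklyStationary.memLp 0).2.ne

/-- An autoregression with a unit root of finite type and a simple pole satisfies the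
Chang--Kim--Park condition. -/
theorem changKimParkCondition_of_solvesAR [IsProbabilityMeasure P] {k : ℕ}
    {a : Fin k → H →L[ℂ] H} {ε x : ℤ → Ω → H}
    (hU : IsUnitRootOfFiniteType a) (hd : HasPoleOfOrder a 1) (hε : IsWhiteNoise P ε)
    (hmeas : ∀ t, Measurable (x t)) (hx : SolvesAR P a x ε) (hpast : HasSubexponentialPast P x) :
    ChangKimParkCondition P x ε := by
  obtain ⟨B, ⟨ρ, hρ, hB⟩, hB1, hAB, hBA⟩ := exists_seriesInverse hU hd
  obtain ⟨C, r, hr0, hr1, hC⟩ := exists_geometric_bound hρ hB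
  have hBs : Summable fun n => ‖B n‖ := by
    simpa using hB 1 (by simpa using hρ)
  refine ⟨hmeas, hε, B, ⟨ρ, hρ, hB⟩, by simpa [arCoeff] using hBA 0, hB1, ?_, ?_, fun t => ?_⟩
  · have h := (summable_pow_mul_geometric_of_norm_lt_one (R := ℝ) 1
      (by rwa [Real.norm_of_nonneg hr0.le])).mul_left C
    refine Summable.of_nonneg_of_le (fun n => by positivity) (fun n => ?_) h
    calc (n : ℝ) * ‖B n‖ ≤ n * (C * r ^ n) := by gcongr; exact hC n
      _ = C * ((n : ℝ) ^ 1 * r ^ n) := by ring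
  · have := hU.finiteType.finite_ker
    refine Submodule.finiteDimensional_of_le (S₂ := LinearMap.ker (arOperator a 1).toLinearMap) ?_
    rintro _ ⟨v, rfl⟩
    exact congrArg (fun T : H →L[ℂ] H => T v) hAB
  · have hm : ∀ n : ℕ, AEStronglyMeasurable (fun ω => B n (ε (t - n) ω)) P := fun n =>
      (B n).continuous.comp_aestronglyMeasurable
        (hε.weaklyStationary.memLp (t - n)).aestronglyMeasurable
    have hfin := hε.tsum_eLpNorm_ne_top hBs t
    have hsum := ae_hasSum_diffProcess hr0 hr1 hC hBA hx hpast t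
      (ae_summable_norm_of_tsum_eLpNorm_ne_top hm hfin)
    exact ⟨hsum, tendsto_eLpNorm_sub_sum hm hfin hsum⟩

end Representation

/-! ### Obstruction from the moving average factor `1 + L` -/

section Noninvertible

variable {H : Type*} [NormedAddCommGroup H] [InnerProductSpace ℂ H]
  [MeasurableSpace H] {Ω : Type*} [MeasurableSpace Ω] {P : Measure Ω}

lemma IsWhiteNoise.memLp_alternating_sum {η : ℤ → Ω → H} (hη : IsWhiteNoise P η) (N : ℕ) :
    MemLp (fun ω => ∑ i ∈ Finset.range N, (-1 : ℂ) ^ i • η i ω) 2 P :=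
  memLp_finsetSum _ fun i _ => (hη.weaklyStationary.memLp i).const_smul ((-1 : ℂ) ^ i)

lemma IsWhiteNoise.integral_alternating_sum [IsProbabilityMeasure P] {η : ℤ → Ω → H} (hη : IsWhiteNoise P η) (N : ℕ) :
    ∫ ω, ∑ i ∈ Finset.range N, (-1 : ℂ) ^ i • η i ω ∂P = 0 := by
  rw [integral_finsetSum]
  · simp [integral_smul, hη.mean_zero]
  · exact fun i _ => ((hη.weaklyStationary.memLp i).integrable (by norm_num)).smul ((-1 : ℂ) ^ i)

/-- The covariance of an alternating sum of white noise grows linearly. -/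
lemma IsWhiteNoise.crossCov_alternating_sum [IsProbabilityMeasure P] {η : ℤ → Ω → H}
    (hη : IsWhiteNoise P η) (N : ℕ) (v : H) :
    crossCov P (fun ω => ∑ i ∈ Finset.range N, (-1 : ℂ) ^ i • η i ω)
      (fun ω => ∑ i ∈ Finset.range N, (-1 : ℂ) ^ i • η i ω) v v =
      N * crossCov P (η 0) (η 0) v v := by
  obtain ⟨γ, hγ⟩ : ∃ γ, crossCov P (η 0) (η 0) v v = γ := ⟨_, rfl⟩
  have hc : ∀ i j : ℕ, ∫ ω, inner ℂ v (η i ω) * (starRingEnd ℂ) (inner ℂ v (η j ω)) ∂P =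
      if i = j then γ else 0 := by
    intro i j
    have h1 : ∫ ω, inner ℂ v (η i ω) * (starRingEnd ℂ) (inner ℂ v (η j ω)) ∂P =
        crossCov P (η i) (η j) v v := by
      simp [crossCov, hη.mean_zero]
    rw [h1, ← hγ]
    split_ifs with h
    · subst h
      simpa using (hη.weaklyStationary.cov_shift 0 0 i v v).symm
    · exact hη.uncorrelated _ _ (by exact_mod_cast Ne.symm h) v v
  have hI : ∀ i j : ℕ, Integrable (fun ω => (-1 : ℂ) ^ i * inner ℂ v (η i ω) *
      ((-1) ^ j * (starRingEnd ℂ) (inner ℂ v (η j ω)))) P := fun i j =>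
    (((hη.weaklyStationary.memLp i).const_inner v).const_mul _).integrable_mul
      (((hη.weaklyStationary.memLp j).const_inner v).star.const_mul _)
  rw [hγ]
  simp only [crossCov, hη.integral_alternating_sum, sub_zero, inner_sum, inner_smul_right, map_sum,
    map_mul, map_pow, map_neg, map_one, Finset.sum_mul_sum]
  rw [integral_finsetSum _ fun i _ => integrable_finsetSum _ fun j _ => hI i j]
  simp_rw [integral_finsetSum _ fun j _ => hI _ j, mul_mul_mul_comm _ (inner ℂ v _),
    integral_const_mul, hc]
  -- Only the diagonal survives, and there the two signs cancel.
  rw [Finset.sum_congr rfl fun i hi => Finset.sum_eq_single_of_mem i hi fun j _ hj => by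
    rw [if_neg hj.symm, mul_zero]]
  simp [← mul_pow]

variable [CompleteSpace H]

/-- If `Δ x = (1 + L) w` with `w` bounded in mean square, then `x` does not solve any finite order
autoregression driven by white noise: the moving average factor `1 + L` is not invertible. -/
theorem not_solvesAR_of_diffProcess_eq [TopologicalSpace.SeparableSpace H]
    [IsProbabilityMeasure P] {x w : ℤ → Ω → H} {K : ENNReal} (hK : K ≠ ⊤) (hw : ∀ t, AEStronglyMeasurable (w t) P)
    (hwK : ∀ t, eLpNorm (w t) 2 P ≤ K)
    (hx : ∀ t ω, diffProcess x t ω = w t ω + w (t - 1) ω) {k : ℕ} (a : Fin k → H →L[ℂ] H)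
    {η : ℤ → Ω → H} (hη : IsWhiteNoise P η) : ¬ SolvesAR P a x η := by
  intro hsol
  -- `D = η - A(L) w`. Applying `A(L)` to `Δ x = (1 + L) w` gives `(1 - L) η = (1 + L) A(L) w`,
  -- hence `(1 + L) D = (1 + L) η - (1 - L) η = 2 L η`.
  set D : ℤ → Ω → H := fun t ω =>
    η t ω - (w t ω - ∑ h : Fin k, a h (w (t - ((h : ℕ) + 1 : ℤ)) ω)) with hD
  have haw : ∀ (t : ℤ) (h : Fin k), AEStronglyMeasurable
      (fun ω => a h (w (t - ((h : ℕ) + 1 : ℤ)) ω)) P := fun t h =>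
    (a h).continuous.comp_aestronglyMeasurable (hw _)
  have hawS : ∀ t : ℤ, AEStronglyMeasurable
      (fun ω => ∑ h : Fin k, a h (w (t - ((h : ℕ) + 1 : ℤ)) ω)) P := fun t =>
    Finset.aestronglyMeasurable_fun_sum _ fun h _ => haw t h
  have hηm : ∀ t, AEStronglyMeasurable (η t) P := fun t =>
    (hη.weaklyStationary.memLp t).aestronglyMeasurable
  have hDm : ∀ t, AEStronglyMeasurable (D t) P := fun t => (hηm t).sub ((hw t).sub (hawS t))
  obtain ⟨M, hM, hDM⟩ : ∃ M : ENNReal, M ≠ ⊤ ∧ ∀ t, eLpNorm (D t) 2 P ≤ M := by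
    refine ⟨eLpNorm (η 0) 2 P + (K + ∑ h : Fin k, ENNReal.ofReal ‖a h‖ * K), ?_, fun t => ?_⟩
    · have := (hη.weaklyStationary.memLp 0).2.ne
      have h2 : ∑ h : Fin k, ENNReal.ofReal ‖a h‖ * K ≠ ⊤ :=
        ENNReal.sum_ne_top.2 fun h _ => ENNReal.mul_ne_top ENNReal.ofReal_ne_top hK
      exact ENNReal.add_ne_top.2 ⟨this, ENNReal.add_ne_top.2 ⟨hK, h2⟩⟩
    · refine (eLpNorm_sub_le (hηm t) ((hw t).sub (hawS t)) (by norm_num)).trans ?_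
      rw [hη.eLpNorm_eq t]
      gcongr
      refine (eLpNorm_sub_le (hw t) (hawS t) (by norm_num)).trans ?_
      gcongr
      · exact hwK t
      · have h1 := eLpNorm_sum_le (p := 2) (s := Finset.univ)
          (f := fun (h : Fin k) ω => a h (w (t - ((h : ℕ) + 1 : ℤ)) ω)) (fun h _ => haw t h)
          (by norm_num)
        refine le_trans (le_of_eq ?_) (h1.trans (Finset.sum_le_sum fun h _ => ?_))
        · congr 1
          funext ω
          simp
        · refine (eLpNorm_le_mul_eLpNorm_of_ae_le_mul
            (Eventually.of_forall fun ω => (a h).le_opNorm _) 2).trans ?_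
          gcongr
          exact hwK _
  have hstep : ∀ᵐ ω ∂P, ∀ t : ℤ, D t ω + D (t + 1) ω = (2 : ℂ) • η t ω := by
    filter_upwards [ae_all_iff.2 hsol] with ω hω t
    have h0 := hω t
    have h1 := hω (t + 1)
    have hdx := hx (t + 1) ω
    have hsum : ∑ h : Fin k, a h (x (t + 1 - ((h : ℕ) + 1 : ℤ)) ω) =
        ∑ h : Fin k, a h (x (t - ((h : ℕ) + 1 : ℤ)) ω) +
          ∑ h : Fin k, a h (w (t + 1 - ((h : ℕ) + 1 : ℤ)) ω) +
          ∑ h : Fin k, a h (w (t - ((h : ℕ) + 1 : ℤ)) ω) := by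
      rw [← Finset.sum_add_distrib, ← Finset.sum_add_distrib]
      refine Finset.sum_congr rfl fun h _ => ?_
      have h2 := hx (t + 1 - ((h : ℕ) + 1 : ℤ)) ω
      simp only [diffProcess] at h2
      rw [show t + 1 - ((h : ℕ) + 1 : ℤ) - 1 = t - ((h : ℕ) + 1 : ℤ) by ring,
        sub_eq_iff_eq_add] at h2
      rw [h2, map_add, map_add]
      abel
    simp only [diffProcess, add_sub_cancel_right] at hdx
    have e0 : η t ω = x t ω - ∑ h : Fin k, a h (x (t - ((h : ℕ) + 1 : ℤ)) ω) := by
      rw [eq_sub_iff_add_eq, add_comm]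
      exact h0.symm
    have e1 : η (t + 1) ω =
        x (t + 1) ω - ∑ h : Fin k, a h (x (t + 1 - ((h : ℕ) + 1 : ℤ)) ω) := by
      rw [eq_sub_iff_add_eq, add_comm]
      exact h1.symm
    simp only [hD]
    rw [two_smul, e1, hsum, sub_eq_iff_eq_add.1 hdx, e0]
    abel
  have hS : ∀ N : ℕ, eLpNorm (fun ω => ∑ i ∈ Finset.range N, (-1 : ℂ) ^ i • η i ω) 2 P ≤
      M + M := by
    intro N
    have hle : ∀ᵐ ω ∂P, ‖∑ i ∈ Finset.range N, (-1 : ℂ) ^ i • η i ω‖ ≤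
        ‖‖D 0 ω‖ + ‖D N ω‖‖ := by
      filter_upwards [hstep] with ω hω
      -- Alternating signs make the sums `D_i + D_{i+1}` telescope, so only the two endpoints
      -- contribute.
      have htel : (2 : ℂ) • ∑ i ∈ Finset.range N, (-1 : ℂ) ^ i • η i ω =
          D 0 ω - (-1 : ℂ) ^ N • D N ω := by
        induction N with
        | zero => simp
        | succ N ih =>
          rw [Finset.sum_range_succ, smul_add, ih, smul_comm, ← hω N, pow_succ]
          push_cast
          module
      have h1 := congrArg norm htel
      rw [norm_smul] at h1
      have h2 := norm_sub_le (D 0 ω) ((-1 : ℂ) ^ N • D N ω)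
      rw [norm_smul] at h2
      simp only [norm_pow, norm_neg, norm_one, one_pow, one_mul, Complex.norm_ofNat] at h1 h2
      rw [Real.norm_of_nonneg (by positivity)]
      linarith [norm_nonneg (∑ i ∈ Finset.range N, (-1 : ℂ) ^ i • η i ω)]
    refine (eLpNorm_mono_ae hle).trans
      ((eLpNorm_add_le (hDm 0).norm (hDm N).norm (by norm_num)).trans ?_)
    rw [eLpNorm_norm, eLpNorm_norm]
    exact add_le_add (hDM 0) (hDM N)
  -- The variance of the alternating sum in direction `v` is `N * c`, yet bounded independently of
  -- `N`.
  have hzero : ∀ v : H, ENNReal.ofReal (crossCov P (η 0) (η 0) v v).re = 0 := by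
    intro v
    set c := ENNReal.ofReal (crossCov P (η 0) (η 0) v v).re with hc
    have hN : ∀ N : ℕ, (N : ENNReal) * c ≤ ‖v‖ₑ ^ 2 * (M + M) ^ 2 := by
      intro N
      have h1 := lintegral_enorm_inner_sq (hη.memLp_alternating_sum N)
        (hη.integral_alternating_sum N) v
      rw [hη.crossCov_alternating_sum, ← Complex.ofReal_natCast, Complex.re_ofReal_mul,
        ENNReal.ofReal_mul (Nat.cast_nonneg N), ENNReal.ofReal_natCast, ← hc] at h1
      rw [← h1]
      calc _ ≤ ∫⁻ ω, ‖v‖ₑ ^ 2 * ‖∑ i ∈ Finset.range N, (-1 : ℂ) ^ i • η i ω‖ₑ ^ 2 ∂P := by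
            refine lintegral_mono fun ω => ?_
            rw [← mul_pow]
            gcongr
            rw [← ofReal_norm, ← ofReal_norm, ← ofReal_norm,
              ← ENNReal.ofReal_mul (norm_nonneg v)]
            exact ENNReal.ofReal_le_ofReal (norm_inner_le_norm _ _)
        _ = ‖v‖ₑ ^ 2 * eLpNorm (fun ω => ∑ i ∈ Finset.range N, (-1 : ℂ) ^ i • η i ω) 2 P ^ 2 := by
            rw [lintegral_const_mul' _ _ (by simp), lintegral_enorm_sq]
        _ ≤ _ := by
            gcongr
            exact hS N
    by_contra hc0
    have htop : ‖v‖ₑ ^ 2 * (M + M) ^ 2 ≠ ⊤ :=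
      ENNReal.mul_ne_top (by simp) (by simp [hM])
    obtain ⟨N, hN'⟩ := ENNReal.exists_nat_mul_gt hc0 htop
    exact absurd (hN N) (not_le.2 hN')
  have hae : η 0 =ᵐ[P] 0 := by
    have : SecondCountableTopology H := UniformSpace.secondCountable_of_separable H
    refine ae_eq_zero_of_forall_inner (𝕜 := ℂ) fun v => ?_
    have h1 := lintegral_enorm_inner_sq (hη.weaklyStationary.memLp 0) (hη.mean_zero 0) v
    rw [hzero v, lintegral_eq_zero_iff'
      ((((hηm 0).const_inner (𝕜 := ℂ) (c := v)).enorm).pow_const 2)] at h1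
    filter_upwards [h1] with ω hω
    simpa using hω
  have hpos := hη.weaklyStationary.second_moment_pos 0
  rw [integral_congr_ae (g := fun _ => 0) (by filter_upwards [hae] with ω hω; simp [hω])] at hpos
  simp at hpos

end Noninvertible

/-! ### Construction of white noise -/

section WhiteNoiseExistence

variable {H : Type*} [NormedAddCommGroup H] [InnerProductSpace ℂ H] [CompleteSpace H]
  [MeasurableSpace H] [BorelSpace H] [TopologicalSpace.SeparableSpace H]

/-- Independent identically distributed centred variables with finite nonzero second moment form
white noise. -/
lemma isWhiteNoise_infinitePi {T : Type*} [MeasurableSpace T] {μ : Measure T}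
    [IsProbabilityMeasure μ] {g : T → H} (hg : Measurable g) (hg2 : MemLp g 2 μ)
    (hg0 : ∫ z, g z ∂μ = 0) (hpos : 0 < ∫ z, ‖g z‖ ^ 2 ∂μ) :
    IsWhiteNoise (Measure.infinitePi fun _ : ℤ => μ) (fun t ω => g (ω t)) := by
  have : SecondCountableTopology H := UniformSpace.secondCountable_of_separable H
  set P := Measure.infinitePi fun _ : ℤ => μ with hP
  have hmp : ∀ t : ℤ, MeasurePreserving (fun ω : ℤ → T => ω t) P μ := fun t =>
    measurePreserving_eval_infinitePi (fun _ : ℤ => μ) t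
  have hint : ∀ {E : Type _} [NormedAddCommGroup E] [NormedSpace ℝ E] (f : T → E) (t : ℤ),
      AEStronglyMeasurable f μ → ∫ ω, f (ω t) ∂P = ∫ z, f z ∂μ := by
    intro E _ _ f t hf
    rw [← (hmp t).map_eq, integral_map (hmp t).aemeasurable]
    rwa [(hmp t).map_eq]
  have hmean : ∀ t : ℤ, ∫ ω, g (ω t) ∂P = 0 := fun t => by
    rw [← (hmp t).map_eq, integral_map (hmp t).aemeasurable] at hg0
    · exact hg0
    · rw [(hmp t).map_eq]
      exact hg2.aestronglyMeasurable
  have hin : ∀ v : H, Measurable fun z => (inner ℂ v (g z) : ℂ) := fun v =>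
    (Continuous.measurable (by fun_prop : Continuous fun y : H => (inner ℂ v y : ℂ))).comp hg
  have hconj : ∀ v : H, Measurable fun z => (starRingEnd ℂ) (inner ℂ v (g z)) := fun v =>
    (RCLike.continuous_conj.measurable).comp (hin v)
  have hcov : ∀ (t s : ℤ) (v w : H),
      crossCov P (fun ω => g (ω t)) (fun ω => g (ω s)) v w =
        if s = t then ∫ z, inner ℂ v (g z) * (starRingEnd ℂ) (inner ℂ w (g z)) ∂μ else 0 := by
    intro t s v w
    simp only [crossCov, hmean, sub_zero]
    split_ifs with h
    · subst h
      exact hint (fun z => inner ℂ v (g z) * (starRingEnd ℂ) (inner ℂ w (g z))) s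
        ((hin v).mul (hconj w)).aestronglyMeasurable
    · have hind : ProbabilityTheory.IndepFun (fun ω : ℤ → T => ω t) (fun ω => ω s) P :=
        (ProbabilityTheory.iIndepFun_infinitePi (P := fun _ : ℤ => μ)
          (X := fun _ z => z) fun _ => measurable_id).indepFun (Ne.symm h)
      rw [hind.integral_fun_comp_mul_comp (hmp t).aemeasurable (hmp s).aemeasurable
        (hin v).aestronglyMeasurable (hconj w).aestronglyMeasurable]
      have h0 : ∫ ω, inner ℂ v (g (ω t)) ∂P = 0 := by
        have h1 : Integrable (fun ω : ℤ → T => g (ω t)) P :=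
          (hg2.comp_measurePreserving (hmp t)).integrable (by norm_num)
        rw [integral_inner h1 v, hmean, inner_zero_right]
      rw [h0, zero_mul]
  refine ⟨⟨fun t => hg.comp (measurable_pi_apply t), fun t => hg2.comp_measurePreserving (hmp t),
    fun t => ?_, fun s t => by rw [hmean, hmean], fun s t r v w => ?_⟩, hmean,
    fun s t hst v w => ?_⟩
  · rw [hint (fun z => ‖g z‖ ^ 2) t (by exact (hg.norm.pow_const 2).aestronglyMeasurable)]
    exact hpos
  · rw [hcov, hcov]
    simp
  · rw [hcov, if_neg hst]

/-- White noise exists on a nontrivial separable Hilbert space: take independent copies of `ξ d_I`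
with `ξ` standard normal, `I` geometric, and `d` a dense sequence rescaled into the unit ball. -/
lemma exists_isWhiteNoise [Nontrivial H] :
    ∃ (Ω : Type) (_ : MeasurableSpace Ω) (P : Measure Ω) (_ : IsProbabilityMeasure P)
      (ε : ℤ → Ω → H), IsWhiteNoise P ε := by
  have : SecondCountableTopology H := UniformSpace.secondCountable_of_separable H
  set s := TopologicalSpace.denseSeq H with hs
  set d : ℕ → H := fun n => (1 + ‖s n‖)⁻¹ • s n with hd
  have hd1 : ∀ n, ‖d n‖ ≤ 1 := fun n => by
    simp only [hd]
    rw [norm_smul, norm_inv, Real.norm_of_nonneg (by positivity), inv_mul_eq_div,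
      div_le_one (by positivity)]
    linarith
  obtain ⟨n₀, hn₀⟩ : ∃ n, d n ≠ 0 := by
    obtain ⟨v, hv⟩ := exists_ne (0 : H)
    obtain ⟨n, hn⟩ := (TopologicalSpace.denseRange_denseSeq H).exists_mem_open
      (isOpen_ne (x := (0 : H))) ⟨v, hv⟩
    exact ⟨n, smul_ne_zero (by positivity) hn⟩
  -- Any parameter strictly between `0` and `1` works: every index, in particular `n₀`, must get
  -- positive mass.
  obtain ⟨p, hp0, hp1⟩ : ∃ p : unitInterval, p ≠ 0 ∧ p ≠ 1 :=
    ⟨⟨1 / 2, by norm_num, by norm_num⟩, fun h => by simpa using congrArg Subtype.val h,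
      fun h => by simpa using congrArg Subtype.val h⟩
  set γ := ProbabilityTheory.gaussianReal 0 1 with hγ
  set ν := ProbabilityTheory.geometricMeasure p with hν
  set g : ℝ × ℕ → H := fun z => z.1 • d z.2 with hg
  have hgm : Measurable g := measurable_fst.smul ((measurable_from_nat (f := d)).comp measurable_snd)
  have hg2 : MemLp g 2 (γ.prod ν) := by
    have h1 : MemLp (fun z : ℝ × ℕ => z.1) 2 (γ.prod ν) :=
      (ProbabilityTheory.memLp_id_gaussianReal 2).comp_fst ν
    refine h1.mono hgm.aestronglyMeasurable (Eventually.of_forall fun z => ?_)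
    rw [norm_smul]
    exact mul_le_of_le_one_right (norm_nonneg _) (hd1 _)
  -- The Gaussian factor is independent of the index and centred, so `d` itself need not have mean
  -- zero.
  have hg0 : ∫ z, g z ∂γ.prod ν = 0 := by
    have := integral_prod_smul (μ := γ) (ν := ν) (fun x : ℝ => x) d
    rwa [ProbabilityTheory.integral_id_gaussianReal, zero_smul] at this
  have hpos : 0 < ∫ z, ‖g z‖ ^ 2 ∂γ.prod ν := by
    rw [integral_pos_iff_support_of_nonneg (fun z => by positivity)
      (hg2.integrable_norm_pow (by norm_num))]
    have hsub : ({0}ᶜ : Set ℝ) ×ˢ ({n₀} : Set ℕ) ⊆ Function.support fun z => ‖g z‖ ^ 2 := by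
      rintro ⟨y, n⟩ ⟨hy, rfl⟩
      simpa [hg] using ⟨hy, hn₀⟩
    refine lt_of_lt_of_le ?_ (measure_mono hsub)
    rw [Measure.prod_prod]
    have : NullSingletonClass γ := ProbabilityTheory.nullSingletonClass_gaussianReal one_ne_zero
    have h1 : γ {0}ᶜ = 1 := by
      rw [prob_compl_eq_one_iff (measurableSet_singleton 0)]
      exact measure_singleton 0
    have h2 := ProbabilityTheory.geometricMeasure_real_singleton_pos hp0 hp1 n₀
    rw [h1, one_mul]
    exact (ENNReal.toReal_pos_iff.1 h2).1
  exact ⟨ℤ → ℝ × ℕ, inferInstance, Measure.infinitePi fun _ => γ.prod ν, inferInstance, _,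
    isWhiteNoise_infinitePi hgm hg2 hg0 hpos⟩

end WhiteNoiseExistence

/-! ### Summing increments over the integers -/

section Summation

/-- The process with prescribed increments that vanishes at time `0`. -/
def cumulativeSum {M : Type*} [AddCommGroup M] (u : ℤ → M) (t : ℤ) : M :=
  ∑ i ∈ Finset.Ioc 0 t, u i - ∑ i ∈ Finset.Ioc t 0, u i

lemma cumulativeSum_sub {M : Type*} [AddCommGroup M] (u : ℤ → M) (t : ℤ) :
    cumulativeSum u t - cumulativeSum u (t - 1) = u t := by
  unfold cumulativeSum
  rcases le_or_gt t 0 with h | h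
  · have h1 : Finset.Ioc (t - 1) 0 = insert t (Finset.Ioc t 0) := by
      ext i
      simp only [Finset.mem_Ioc, Finset.mem_insert]
      omega
    rw [Finset.Ioc_eq_empty (by omega : ¬ 0 < t), Finset.Ioc_eq_empty (by omega : ¬ 0 < t - 1), h1,
      Finset.sum_insert (by simp)]
    simp
  · have h1 : Finset.Ioc 0 t = insert t (Finset.Ioc 0 (t - 1)) := by
      ext i
      simp only [Finset.mem_Ioc, Finset.mem_insert]
      omega
    rw [Finset.Ioc_eq_empty (by omega : ¬ t < 0), Finset.Ioc_eq_empty (by omega : ¬ t - 1 < 0), h1,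
      Finset.sum_insert (by simp)]
    simp

end Summation

/-! ### The counterexample -/

section MovingAverage

variable {H : Type*} [NormedAddCommGroup H] [InnerProductSpace ℂ H]

/-- The coefficients of `(1 + z) (1 - z (1 - Q)) = 1 + z Q - z² (1 - Q)`. -/
def maCoeff (Q : H →L[ℂ] H) : ℕ → H →L[ℂ] H
  | 0 => 1
  | 1 => Q
  | 2 => -(1 - Q)
  | _ + 3 => 0

lemma maCoeff_eq_zero (Q : H →L[ℂ] H) {n : ℕ} (hn : n ∉ Finset.range 3) : maCoeff Q n = 0 := by
  obtain ⟨m, rfl⟩ := Nat.exists_eq_add_of_le' (show 3 ≤ n by simpa using hn)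
  rfl

lemma tsum_maCoeff (Q : H →L[ℂ] H) : ∑' n, maCoeff Q n = (2 : ℂ) • Q := by
  rw [tsum_eq_sum fun n hn => maCoeff_eq_zero Q hn]
  simp only [Finset.sum_range_succ, Finset.range_zero, Finset.sum_empty, maCoeff]
  module

variable [CompleteSpace H] [MeasurableSpace H] [BorelSpace H] [TopologicalSpace.SeparableSpace H]
  {Ω : Type*} [MeasurableSpace Ω] {P : Measure Ω} [IsProbabilityMeasure P]

/-- Integrated moving averages `Δ x_t = (1 + L) (1 - (1 - Q) L) ε_t` with `Q` of finite nonzero rank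
satisfy the Chang--Kim--Park condition without solving a finite order autoregression. -/
theorem exists_changKimParkCondition_not_solvesAR {ε : ℤ → Ω → H} (hε : IsWhiteNoise P ε)
    {Q : H →L[ℂ] H} (hQ0 : Q ≠ 0) (hQ : FiniteDimensional ℂ (LinearMap.range Q.toLinearMap)) :
    ∃ x : ℤ → Ω → H, ChangKimParkCondition P x ε ∧
      ∀ (k : ℕ) (a : Fin k → H →L[ℂ] H) (η : ℤ → Ω → H), IsWhiteNoise P η →
        ¬ SolvesAR P a x η := by
  have : SecondCountableTopology H := UniformSpace.secondCountable_of_separable H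
  have hεm : ∀ t, Measurable (ε t) := hε.weaklyStationary.measurable
  -- The factor `1 - (1 - Q) L` becomes `Q` at `L = 1` and so makes `B(1)` of finite rank; the
  -- factor `1 + L` is kept apart as the obstruction.
  set w : ℤ → Ω → H := fun t ω => ε t ω - (1 - Q) (ε (t - 1) ω) with hw
  have hQε : ∀ t, Measurable fun ω => (1 - Q) (ε (t - 1) ω) := fun t =>
    (1 - Q).continuous.measurable.comp (hεm _)
  have hwm : ∀ t, Measurable (w t) := fun t => (hεm t).sub (hQε t)
  set x : ℤ → Ω → H := fun t ω => cumulativeSum (fun i => w i ω + w (i - 1) ω) t with hx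
  have hdx : ∀ t ω, diffProcess x t ω = w t ω + w (t - 1) ω := fun t ω =>
    cumulativeSum_sub (fun i => w i ω + w (i - 1) ω) t
  have hxm : ∀ t, Measurable (x t) := fun t => by
    have hu : ∀ i, Measurable fun ω => w i ω + w (i - 1) ω := fun i => (hwm i).add (hwm _)
    exact (Finset.measurable_fun_sum _ fun i _ => hu i).sub
      (Finset.measurable_fun_sum _ fun i _ => hu i)
  -- Partial sums with at least three terms are exact, so both modes of convergence are immediate.
  have hfil : ∀ (t : ℤ) (ω : Ω) (N : ℕ), 3 ≤ N →
      ∑ n ∈ Finset.range N, maCoeff Q n (ε (t - n) ω) = diffProcess x t ω := by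
    intro t ω N hN
    rw [← Finset.sum_subset (Finset.range_mono hN) fun n _ hn => by
      rw [maCoeff_eq_zero Q hn, zero_apply], hdx]
    simp only [Finset.sum_range_succ, Finset.range_zero, Finset.sum_empty, maCoeff, hw]
    rw [sub_sub]
    simp
    abel
  have hsupp : ∀ c : ℕ → ℝ, Summable fun n => c n * ‖maCoeff Q n‖ := fun c =>
    summable_of_ne_finset_zero (s := Finset.range 3) fun n hn => by
      rw [maCoeff_eq_zero Q hn, norm_zero, mul_zero]
  refine ⟨x, ⟨hxm, hε, maCoeff Q, ⟨2, one_lt_two, fun z _ => ?_⟩, rfl, ?_, hsupp _, ?_,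
    fun t => ⟨Eventually.of_forall fun ω => ?_, ?_⟩⟩, fun k a η hη => ?_⟩
  · simpa [mul_comm] using hsupp fun n => ‖z‖ ^ n
  · rw [tsum_maCoeff]
    exact smul_ne_zero two_ne_zero hQ0
  · rw [tsum_maCoeff]
    refine Submodule.finiteDimensional_of_le (S₂ := LinearMap.range Q.toLinearMap) ?_
    rintro _ ⟨v, rfl⟩
    exact ⟨(2 : ℂ) • v, by simp⟩
  · rw [← hfil t ω 3 le_rfl]
    exact hasSum_sum_of_ne_finset_zero fun n hn => by rw [maCoeff_eq_zero Q hn, zero_apply]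
  · refine tendsto_const_nhds.congr' ?_
    filter_upwards [eventually_ge_atTop 3] with N hN
    simp [hfil t _ N hN]
  · have hK : eLpNorm (ε 0) 2 P + ENNReal.ofReal ‖1 - Q‖ * eLpNorm (ε 0) 2 P ≠ ⊤ := by
      have := (hε.weaklyStationary.memLp 0).2.ne
      exact ENNReal.add_ne_top.2 ⟨this, ENNReal.mul_ne_top ENNReal.ofReal_ne_top this⟩
    refine not_solvesAR_of_diffProcess_eq hK (fun t => (hwm t).aestronglyMeasurable) (fun t => ?_)
      hdx a hη
    refine (eLpNorm_sub_le (hεm t).aestronglyMeasurable (hQε t).aestronglyMeasurable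
      (by norm_num)).trans ?_
    refine add_le_add (hε.eLpNorm_eq t).le ?_
    rw [← hε.eLpNorm_eq (t - 1)]
    exact eLpNorm_le_mul_eLpNorm_of_ae_le_mul
      (Eventually.of_forall fun ω => (1 - Q).le_opNorm _) 2

end MovingAverage

theorem mainTheorem11 {H : Type*} [NormedAddCommGroup H] [InnerProductSpace ℂ H] [CompleteSpace H]
    [TopologicalSpace.SeparableSpace H] [MeasurableSpace H] [BorelSpace H]
    (hH : ¬ FiniteDimensional ℂ H) :
    -- an autoregression with a unit root of finite type and `d = 1` satisfies the condition
    (∀ {Ω : Type*} [MeasurableSpace Ω] (P : Measure Ω) [IsProbabilityMeasure P]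
      {k : ℕ} (a : Fin k → H →L[ℂ] H) (ε x : ℤ → Ω → H),
      IsUnitRootOfFiniteType a → HasPoleOfOrder a 1 →
      IsWhiteNoise P ε → (∀ t, Measurable (x t)) → SolvesAR P a x ε →
      HasSubexponentialPast P x →
      ChangKimParkCondition P x ε) ∧
    -- the converse fails
    (∃ (Ω : Type) (_ : MeasurableSpace Ω) (P : Measure Ω) (_ : IsProbabilityMeasure P)
      (ε x : ℤ → Ω → H),
      ChangKimParkCondition P x ε ∧
      ∀ (k : ℕ) (a : Fin k → H →L[ℂ] H) (η : ℤ → Ω → H),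
        IsUnitRootOfFiniteType a → IsWhiteNoise P η → ¬ SolvesAR P a x η) := by
  constructor
  · intro Ω _ P _ k a ε x hU hd hε hx hsol hpast
    exact changKimParkCondition_of_solvesAR hU hd hε hx hsol hpast
  have hnt : Nontrivial H := by
    by_contra h
    rw [not_nontrivial_iff_subsingleton] at h
    exact hH inferInstance
  obtain ⟨Ω, mΩ, P, hP, ε, hε⟩ := exists_isWhiteNoise (H := H)
  obtain ⟨e, he⟩ := exists_ne (0 : H)
  -- Here `Q` is the orthogonal projection onto a line; it fixes `e`, hence is nonzero.
  have hQ0 : (ℂ ∙ e).starProjection ≠ 0 := fun h => he <| by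
    simpa [h] using
      (Submodule.starProjection_eq_self_iff.2 (Submodule.mem_span_singleton_self (R := ℂ) e)).symm
  have hQ : FiniteDimensional ℂ (LinearMap.range (ℂ ∙ e).starProjection.toLinearMap) := by
    refine Submodule.finiteDimensional_of_le (S₂ := ℂ ∙ e) ?_
    rintro _ ⟨v, rfl⟩
    exact Submodule.starProjection_apply_mem _ v
  obtain ⟨x, hx, hnot⟩ := exists_changKimParkCondition_not_solvesAR hε hQ0 hQ
  exact ⟨Ω, mΩ, P, hP, ε, x, hx, fun k a η _ hη => hnot k a η hη⟩

end
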